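/- Notation. A function $f:[0,\infty)\to\mathbb R\cup\{+\infty\}$ is an entropy function if it is convex and lower semicontinuous with $f(1)=0$ and $\lim_{t\to\infty}f(t)/t>0$. Let $K\in\mathbb N$. For probability measures $\alpha,\beta$ on $\mathbb R$ let $Q^{(K)}_{\alpha\mid\beta}$ be the probability mass function on $\{0,\dots,K\}$ of the rank $\#\{1\le j\le K:\tilde Y_j\le Y\}$, where $Y\sim\alpha$ and $\tilde Y_1,\dots,\tilde Y_K\sim\beta$ are independent, and put $$D^{(K)}_{f,\beta}(\alpha)=\frac1{K+1}\sum_{n=0}^K f\bigl((K+1)\,Q^{(K)}_{\alpha\mid\beta}(n)\bigr).$$ For probability measures $\mu,\nu$ on $\mathbb R^d$ let $\mu_s,\nu_s$ be their images under $x\mapsto\langle s,x\rangle$, $s\in\mathbb S^{d-1}$, let $\sigma$ be the uniform probability measure on $\mathbb S^{d-1}$, and let $$D^{(K)}_{f,\nu}(\mu)=\int_{\mathbb S^{d-1}}D^{(K)}_{f,\nu_s}(\mu_s)\,d\sigma(s).$$ Theorem. Fix $K\in\mathbb N$, an entropy function $f$ that is finite and continuously differentiable on $[0,K+1]$, and probability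 measures $\mu\ne\nu$ on $\mathbb R^d$ with $D^{(K)}_{f,\nu}(\mu)>0$. Let $X_1,X_2,\dots$ be i.i.d. with law $\mu$ and $\hat\mu_N=\frac1N\sum_{i=1}^N\delta_{X_i}$. For $x\in\mathbb R^d$ let $\phi_{n,s}(x)$ be the probability that exactly $n$ of $K$ independent draws from $\nu_s$ are at most $\langle s,x\rangle$, and let $$g(x)=\int_{\mathbb S^{d-1}}\sum_{n=0}^K f'\bigl((K+1)\,Q^{(K)}_{\mu_s\mid\nu_s}(n)\bigr)\,\phi_{n,s}(x)\,d\sigma(s),\qquad \tau_K^2=\operatorname{Var}\bigl(g(X_1)\bigr).$$ Then, as $N\to\infty$, $$\sqrt N\Bigl(D^{(K)}_{f,\nu}(\hat\mu_N)-D^{(K)}_{f,\nu}(\mu)\Bigr)\xrightarrow{d}\mathcal N(0,\tau_K^2),$$ where $\mathcal N(0,0)$ is the point mass at $0$; and $\tau_K^2>0$ if and only if $g$ is not $\mu$-almost surely constant. In particular, if $g$ is not $\mu$-almost surely constant, the limit is a nondegenerate centred normal law. -/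

import Mathlib

open MeasureTheory ProbabilityTheory Filter Topology

noncomputable section

namespace RankDiv

/-- Entropy functions `f : [0,∞) → ℝ ∪ {+∞}`: convex, lower semicontinuous, `f 1 = 0` and
`lim_{t → ∞} f t / t > 0` (the limit may be `+∞`). Only the values on `[0,∞)` matter. -/
structure IsEntropyFunction (f : ℝ → EReal) : Prop where
  ne_bot : ∀ t, 0 ≤ t → f t ≠ ⊥
  convex : ∀ x y a b : ℝ, 0 ≤ x → 0 ≤ y → 0 ≤ a → 0 ≤ b → a + b = 1 →
    f (a * x + b * y) ≤ (a : EReal) * f x + (b : EReal) * f y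
  lsc : LowerSemicontinuousOn f (Set.Ici 0)
  one : f 1 = 0
  growth : ∃ c : EReal, 0 < c ∧ Tendsto (fun t : ℝ => f t / (t : EReal)) atTop (𝓝 c)

/-- `f` is finite and continuously differentiable on `[0, K + 1]` (one-sided at the end points). -/
def IsC1 (f : ℝ → EReal) (K : ℕ) : Prop :=
  (∀ t ∈ Set.Icc (0 : ℝ) (K + 1), f t ≠ ⊤) ∧
    ContDiffOn ℝ 1 (fun t => (f t).toReal) (Set.Icc (0 : ℝ) (K + 1))

/-- The number of those `y_1, …, y_K` that are at most `x`. -/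
def rank {K : ℕ} (x : ℝ) (y : Fin K → ℝ) : ℕ :=
  (Finset.univ.filter fun j => y j ≤ x).card

/-- The probability mass function at `n` of the rank of `Y ∼ μ` among `K` independent draws
from `ν` that are also independent of `Y`. -/
def rankPMF (K : ℕ) (μ ν : Measure ℝ) (n : ℕ) : ℝ :=
  (μ.prod (Measure.pi fun _ : Fin K => ν)).real {p | rank p.1 p.2 = n}

/-- The probability that the fixed point `x` has rank `n` among `K` independent draws from `ν`. -/
def rankProb (K : ℕ) (ν : Measure ℝ) (x : ℝ) (n : ℕ) : ℝ :=
  (Measure.pi fun _ : Fin K => ν).real {y | rank x y = n}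

/-- The univariate rank-statistic `f`-divergence of order `K` of `μ` to `ν`: the discrete
`f`-divergence of the rank distribution from the uniform distribution on `{0, …, K}`. -/
def rankDivergence (f : ℝ → EReal) (K : ℕ) (μ ν : Measure ℝ) : EReal :=
  (((K + 1 : ℝ)⁻¹ : ℝ) : EReal) *
    ∑ n ∈ Finset.range (K + 1), f ((K + 1) * rankPMF K μ ν n)

/-- The unit sphere of `ℝ^d`. -/
abbrev USphere (d : ℕ) : Type := Metric.sphere (0 : EuclideanSpace ℝ (Fin d)) 1

/-- The uniform probability measure on the unit sphere (for `d ≥ 1`): the normalized surface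
measure, and the normalized counting measure on `{-1, 1}` if `d = 1`. -/
def uniformSphere (d : ℕ) : Measure (USphere d) :=
  ((volume : Measure (EuclideanSpace ℝ (Fin d))).toSphere Set.univ)⁻¹ •
    (volume : Measure (EuclideanSpace ℝ (Fin d))).toSphere

/-- The image of `μ` under the projection `x ↦ ⟨s, x⟩`. -/
def slice {d : ℕ} (μ : Measure (EuclideanSpace ℝ (Fin d))) (s : USphere d) : Measure ℝ :=
  μ.map fun x => inner ℝ (s : EuclideanSpace ℝ (Fin d)) x

/-- The sliced rank-statistic `f`-divergence of order `K`, with values in `[0, ∞]`. For an entropy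
function and probability measures the integrand is nonnegative by Jensen's inequality (the rank
distribution has mass one and `f 1 = 0`), so that `EReal.toENNReal` does not change it. -/
def slicedRankDivergence {d : ℕ} (f : ℝ → EReal) (K : ℕ)
    (μ ν : Measure (EuclideanSpace ℝ (Fin d))) : ENNReal :=
  ∫⁻ s, (rankDivergence f K (slice μ s) (slice ν s)).toENNReal ∂(uniformSphere d)

/-- The empirical measure `N⁻¹ ∑_{i < N} δ_{x_i}` (for `N ≥ 1`). -/
def empiricalMeasure {E : Type*} [MeasurableSpace E] (x : ℕ → E) (N : ℕ) : Measure E :=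
  (N : ENNReal)⁻¹ • ∑ i ∈ Finset.range N, Measure.dirac (x i)

/-- The function `x ↦ ∫ ∑_n f'((K+1) Q_s(n)) φ_{n,s}(x) dσ(s)`, where `Q_s` is the rank
distribution of `⟨s, Y⟩`, `Y ∼ μ`, and `φ_{n,s}(x)` the probability that `⟨s, x⟩` has rank `n`,
both among `K` draws from the projection of `ν` along `s`. -/
def linearization {d : ℕ} (f : ℝ → EReal) (K : ℕ)
    (μ ν : Measure (EuclideanSpace ℝ (Fin d))) (x : EuclideanSpace ℝ (Fin d)) : ℝ :=
  ∫ s : USphere d, ∑ n ∈ Finset.range (K + 1),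
    derivWithin (fun t => (f t).toReal) (Set.Icc (0 : ℝ) (K + 1))
        ((K + 1) * rankPMF K (slice μ s) (slice ν s) n) *
      rankProb K (slice ν s) (inner ℝ (s : EuclideanSpace ℝ (Fin d)) x) n
    ∂(uniformSphere d)

end RankDiv

end

noncomputable section

namespace RankDiv

/-! The rank distribution is linear in its first argument: `Q(n)` is the integral of `φ_{n,s}`
against `μ`. At the empirical measure it is therefore a sample mean of bounded i.i.d. variables, and
the divergence is an integral of `F(sample mean)` over the parameter `(s, n)`, with `F` a `C¹`
function on `[0, K+1]`. The theorem is thus a delta method integrated over a parameter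
(`tendstoInDistribution_integral_sampleMean`).

By Fubini, the linear term is the centred sample mean of `g`, to which the classical CLT applies.
The remainder needs no functional CLT: the Taylor error is at most `ε|Δ| + CΔ²` with constants
uniform in the parameter (`exists_taylor_bound`), and `N·E[Δ²]` is bounded uniformly as well
(`lintegral_sq_sampleMean_le`). So `√N` times the integrated remainder vanishes in `L¹`
(`tendsto_lintegral_remainder`), and Slutsky's theorem concludes. Convexity of `f` serves only to
make the divergence nonnegative, so that its `ENNReal` integral is a real one. -/

/-! ### Delta method for integrals of functions of sample means -/

/-- First-order Taylor estimate for a `C¹` function on a compact interval, with a uniform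
remainder. -/
lemma exists_taylor_bound {F : ℝ → ℝ} {a b : ℝ} (hab : a < b)
    (hF : ContDiffOn ℝ 1 F (Set.Icc a b)) {ε : ℝ} (hε : 0 < ε) :
    ∃ C : ℝ, 0 ≤ C ∧ ∀ x ∈ Set.Icc a b, ∀ y ∈ Set.Icc a b,
      |F y - F x - derivWithin F (Set.Icc a b) x * (y - x)| ≤ ε * |y - x| + C * (y - x) ^ 2 := by
  set F' := derivWithin F (Set.Icc a b)
  have hc : ContinuousOn F' (Set.Icc a b) :=
    hF.continuousOn_derivWithin (uniqueDiffOn_Icc hab) le_rfl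
  have hd : ∀ x ∈ Set.Icc a b, HasDerivWithinAt F (F' x) (Set.Icc a b) x := fun x hx =>
    (hF.differentiableOn one_ne_zero x hx).hasDerivWithinAt
  obtain ⟨M, hM⟩ := isCompact_Icc.exists_bound_of_continuousOn hc
  have hM0 : 0 ≤ M := (norm_nonneg _).trans (hM a ⟨le_rfl, hab.le⟩)
  obtain ⟨δ, hδ, hu⟩ := Metric.uniformContinuousOn_iff.1
    (isCompact_Icc.uniformContinuousOn_of_continuous hc) ε hε
  -- Mean value inequality for `z ↦ F z - F' x * z` on the segment from `x` to `y`.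
  have key : ∀ x ∈ Set.Icc a b, ∀ y ∈ Set.Icc a b, ∀ B : ℝ,
      (∀ z ∈ Set.uIcc x y, |F' z - F' x| ≤ B) →
      |F y - F x - F' x * (y - x)| ≤ B * |y - x| := by
    intro x hx y hy B hB
    have hsub : Set.uIcc x y ⊆ Set.Icc a b := Set.uIcc_subset_Icc hx hy
    have := (convex_uIcc x y).norm_image_sub_le_of_norm_hasDerivWithin_le
      (f := fun z => F z - F' x * z) (f' := fun z => F' z - F' x) (C := B)
      (fun z hz => ((hd z (hsub hz)).mono hsub).sub
        (by simpa using (hasDerivWithinAt_id z _).const_mul (F' x)))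
      hB Set.left_mem_uIcc Set.right_mem_uIcc
    simp only [Real.norm_eq_abs] at this
    convert this using 2
    ring
  -- Within `δ`, uniform continuity of `F'` gives the `ε` term. Beyond it, `F'` varies by at most
  -- `2M` and `|y - x| ≤ (y - x)² / δ`.
  refine ⟨2 * M / δ, by positivity, fun x hx y hy => ?_⟩
  rcases lt_or_ge |y - x| δ with h | h
  · refine (key x hx y hy ε fun z hz => ?_).trans (by
      have : 0 ≤ 2 * M / δ * (y - x) ^ 2 := by positivity
      linarith)
    have hzx : |z - x| ≤ |y - x| := Set.abs_sub_left_of_mem_uIcc hz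
    exact (hu z (Set.uIcc_subset_Icc hx hy hz) x hx (hzx.trans_lt h)).le
  · refine (key x hx y hy (2 * M) fun z hz => ?_).trans ?_
    · have h1 := hM z (Set.uIcc_subset_Icc hx hy hz)
      have h2 := hM x hx
      rw [Real.norm_eq_abs] at h1 h2
      linarith [abs_sub (F' z) (F' x)]
    · have h1 : 2 * M * |y - x| ≤ 2 * M / δ * (y - x) ^ 2 := by
        rw [← sq_abs, div_mul_eq_mul_div, le_div_iff₀ hδ]
        nlinarith [mul_nonneg (mul_nonneg zero_le_two hM0) (abs_nonneg (y - x))]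
      have : 0 ≤ ε * |y - x| := by positivity
      linarith

/-- The rescaled mean square error of the sample mean of a bounded function is bounded. -/
lemma lintegral_sq_sampleMean_le {E Ω : Type*} [MeasurableSpace E] [MeasurableSpace Ω]
    {μ : Measure E} {P : Measure Ω} [IsProbabilityMeasure P] {X : ℕ → Ω → E}
    (hX : ∀ i, HasLaw (X i) μ P) (hindep : iIndepFun X P) {ψ : E → ℝ} (hψ : Measurable ψ)
    {b : ℝ} (hψb : ∀ x, ψ x ∈ Set.Icc 0 b) {N : ℕ} (hN : N ≠ 0) :
    ∫⁻ ω, ENNReal.ofReal (N * ((N : ℝ)⁻¹ * ∑ i ∈ Finset.range N, ψ (X i ω) - ∫ x, ψ x ∂μ) ^ 2) ∂P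
      ≤ ENNReal.ofReal (b ^ 2) := by
  have hae : ∀ i, AEMeasurable (ψ ∘ X i) P := fun i => hψ.comp_aemeasurable (hX i).aemeasurable
  have hLp : ∀ i, MemLp (ψ ∘ X i) 2 P := fun i =>
    MemLp.of_bound (hae i).aestronglyMeasurable b (ae_of_all _ fun ω => by
      rw [Real.norm_eq_abs, Function.comp_apply, abs_of_nonneg (hψb _).1]; exact (hψb _).2)
  have hint : ∀ i, ∫ ω, ψ (X i ω) ∂P = ∫ x, ψ x ∂μ := fun i =>
    (hX i).integral_comp hψ.aestronglyMeasurable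
  have hN0 : (0 : ℝ) < N := by positivity
  set Y : Ω → ℝ := fun ω => (√N)⁻¹ * (∑ i ∈ Finset.range N, ψ ∘ X i) ω
  have hYLp : MemLp Y 2 P := (memLp_finsetSum' _ fun i _ => hLp i).const_mul _
  have hYint : ∫ ω, Y ω ∂P = (√N)⁻¹ * (N * ∫ x, ψ x ∂μ) := by
    simp only [Y, Finset.sum_apply, Function.comp_apply]
    rw [integral_const_mul, integral_finsetSum (f := fun i ω => ψ (X i ω)) _
      fun i _ => (hLp i).integrable one_le_two]
    simp [hint]
  have hvar : Var[Y; P] ≤ b ^ 2 := by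
    rw [variance_const_mul, IndepFun.variance_sum (fun i _ => hLp i)
      (fun i _ j _ hij => (hindep.indepFun hij).comp hψ hψ), inv_pow, Real.sq_sqrt hN0.le]
    rw [inv_mul_le_iff₀ hN0]
    refine (Finset.sum_le_card_nsmul _ _ (b ^ 2) fun i _ => ?_).trans (by simp)
    -- Popoviciu's bound `(b / 2)²`; the cruder `b²` suffices.
    have := variance_le_sq_of_bounded (ae_of_all P fun ω => hψb (X i ω)) (hae i)
    refine this.trans ?_
    nlinarith [sq_nonneg b]
  calc _ = eVar[Y; P] := by
        rw [evariance_eq_lintegral_ofReal]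
        refine lintegral_congr fun ω => ?_
        rw [hYint]
        congr 1
        simp only [Y, Finset.sum_apply, Function.comp_apply]
        rw [← mul_sub, mul_pow, inv_pow, Real.sq_sqrt hN0.le]
        field_simp
    _ = ENNReal.ofReal Var[Y; P] := (ofReal_variance hYLp).symm
    _ ≤ _ := ENNReal.ofReal_le_ofReal hvar

/-- The remainder in the first-order expansion of an integral functional of sample means, rescaled
by `√N`, tends to zero in `L¹`. -/
lemma tendsto_lintegral_remainder {E Ω S : Type*} [MeasurableSpace E] [MeasurableSpace Ω]
    [MeasurableSpace S] {σ : Measure S} [IsProbabilityMeasure σ]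
    {μ : Measure E} [IsProbabilityMeasure μ] {P : Measure Ω} [IsProbabilityMeasure P]
    {X : ℕ → Ω → E} (hX : ∀ i, HasLaw (X i) μ P) (hindep : iIndepFun X P)
    {φ : S → E → ℝ} (hφ : Measurable (Function.uncurry φ)) {b : ℝ} (hb : 0 < b)
    (hφb : ∀ s x, φ s x ∈ Set.Icc 0 b) {F : ℝ → ℝ} (hF : ContDiffOn ℝ 1 F (Set.Icc 0 b)) :
    Tendsto (fun N : ℕ => ∫⁻ ω, ‖√(N : ℝ) * ∫ s,
      (F ((N : ℝ)⁻¹ * ∑ i ∈ Finset.range N, φ s (X i ω)) - F (∫ x, φ s x ∂μ) -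
        derivWithin F (Set.Icc 0 b) (∫ x, φ s x ∂μ) *
          ((N : ℝ)⁻¹ * ∑ i ∈ Finset.range N, φ s (X i ω) - ∫ x, φ s x ∂μ)) ∂σ‖ₑ ∂P)
      atTop (𝓝 0) := by
  have hφs : ∀ s, Measurable (φ s) := fun s => hφ.of_uncurry_left
  have hmean : Measurable fun s => ∫ x, φ s x ∂μ :=
    (hφ.stronglyMeasurable.integral_prod_right').measurable
  have hmem : ∀ s, ∫ x, φ s x ∂μ ∈ Set.Icc 0 b := fun s => by
    have hi : Integrable (φ s) μ := .of_bound (hφs s).aestronglyMeasurable b (ae_of_all _ fun x => by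
      rw [Real.norm_eq_abs, abs_of_nonneg (hφb _ _).1]; exact (hφb _ _).2)
    refine ⟨integral_nonneg fun x => (hφb s x).1, ?_⟩
    simpa using integral_mono hi (integrable_const b) fun x => (hφb s x).2
  have hmemN : ∀ (N : ℕ) s ω, (N : ℝ)⁻¹ * ∑ i ∈ Finset.range N, φ s (X i ω) ∈ Set.Icc 0 b := by
    intro N s ω
    refine ⟨mul_nonneg (by positivity) (Finset.sum_nonneg fun i _ => (hφb _ _).1), ?_⟩
    rcases Nat.eq_zero_or_pos N with rfl | hN
    · simpa using hb.le
    · rw [inv_mul_le_iff₀ (by positivity)]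
      exact (Finset.sum_le_card_nsmul _ _ b fun i _ => (hφb _ _).2).trans (by simp)
  set Δ : ℕ → S → Ω → ℝ := fun N s ω =>
    (N : ℝ)⁻¹ * ∑ i ∈ Finset.range N, φ s (X i ω) - ∫ x, φ s x ∂μ
  have hΔ : ∀ N, AEMeasurable (Function.uncurry (Δ N)) (σ.prod P) := by
    intro N
    refine (AEMeasurable.const_mul (Finset.aemeasurable_fun_sum _ fun i _ => ?_) _).sub
      (hmean.comp measurable_fst).aemeasurable
    exact hφ.comp_aemeasurable (measurable_fst.aemeasurable.prodMk
      ((hX i).aemeasurable.comp_quasiMeasurePreserving Measure.quasiMeasurePreserving_snd))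
  rw [ENNReal.tendsto_nhds_zero]
  intro η hη
  obtain ⟨ε, hε, hεη⟩ : ∃ ε : ℝ, 0 < ε ∧ ENNReal.ofReal (ε + 2 * ε * b ^ 2) ≤ η := by
    rcases eq_or_ne η ⊤ with rfl | hη'
    · exact ⟨1, one_pos, le_top⟩
    refine ⟨η.toReal / (1 + 2 * b ^ 2),
      div_pos (ENNReal.toReal_pos hη.ne' hη') (by positivity), ?_⟩
    rw [← ENNReal.ofReal_toReal hη']
    refine ENNReal.ofReal_le_ofReal (le_of_eq ?_)
    rw [ENNReal.toReal_ofReal ENNReal.toReal_nonneg]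
    field_simp
  obtain ⟨C, hC, hT⟩ := exists_taylor_bound hb hF hε
  have hlim : Tendsto (fun N : ℕ => C / √(N : ℝ)) atTop (𝓝 0) :=
    (Real.tendsto_sqrt_atTop.comp tendsto_natCast_atTop_atTop).const_div_atTop C
  filter_upwards [hlim.eventually (ge_mem_nhds hε), eventually_gt_atTop 0] with N hCN hN
  have hN0 : (0 : ℝ) < N := by positivity
  have hs0 : 0 < √(N : ℝ) := Real.sqrt_pos.2 hN0
  have hsq : √(N : ℝ) ^ 2 = N := Real.sq_sqrt hN0.le
  refine le_trans ?_ hεη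
  calc _ ≤ ∫⁻ ω, ∫⁻ s, ENNReal.ofReal (ε + 2 * ε * (N * Δ N s ω ^ 2)) ∂σ ∂P := by
        refine lintegral_mono fun ω => ?_
        rw [← integral_const_mul]
        refine (enorm_integral_le_lintegral_enorm _).trans (lintegral_mono fun s => ?_)
        rw [Real.enorm_eq_ofReal_abs]
        refine ENNReal.ofReal_le_ofReal ?_
        rw [abs_mul, abs_of_pos hs0]
        have h1 := hT _ (hmem s) _ (hmemN N s ω)
        change |F _ - F _ - _ * Δ N s ω| ≤ ε * |Δ N s ω| + C * Δ N s ω ^ 2 at h1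
        refine (mul_le_mul_of_nonneg_left h1 hs0.le).trans ?_
        -- For large `N` the quadratic error is absorbed into `ε * (N * Δ²)`; the linear one is
        -- handled by `r ≤ 1 + r²` in `h3`.
        have h2 : C * √(N : ℝ) ≤ ε * N := by
          rw [div_le_iff₀ hs0] at hCN
          calc C * √(N : ℝ) ≤ (ε * √(N : ℝ)) * √(N : ℝ) :=
                mul_le_mul_of_nonneg_right hCN hs0.le
            _ = ε * N := by rw [mul_assoc, ← sq, hsq]
        have h3 : √(N : ℝ) * |Δ N s ω| ≤ 1 + N * Δ N s ω ^ 2 := by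
          have h4 : (√(N : ℝ) * |Δ N s ω|) ^ 2 = N * Δ N s ω ^ 2 := by rw [mul_pow, hsq, sq_abs]
          nlinarith [sq_nonneg (√(N : ℝ) * |Δ N s ω| - 1)]
        nlinarith [mul_le_mul_of_nonneg_left h3 hε.le,
          mul_le_mul_of_nonneg_right h2 (sq_nonneg (Δ N s ω))]
    -- After Tonelli, the variance bound applies for each fixed `s`.
    _ = ∫⁻ s, ∫⁻ ω, ENNReal.ofReal (ε + 2 * ε * (N * Δ N s ω ^ 2)) ∂P ∂σ := by
        refine (lintegral_lintegral_swap ?_).symm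
        exact (((((hΔ N).pow_const 2).const_mul _).const_mul _).const_add ε).ennreal_ofReal
    _ ≤ ∫⁻ _ : S, ENNReal.ofReal (ε + 2 * ε * b ^ 2) ∂σ := by
        refine lintegral_mono fun s => ?_
        have : ∀ ω, ENNReal.ofReal (ε + 2 * ε * (N * Δ N s ω ^ 2)) =
            ENNReal.ofReal ε + ENNReal.ofReal (2 * ε) * ENNReal.ofReal (N * Δ N s ω ^ 2) := by
          intro ω
          rw [ENNReal.ofReal_add hε.le (by positivity), ENNReal.ofReal_mul (by positivity)]
        simp_rw [this]
        rw [lintegral_add_left measurable_const, lintegral_const_mul' _ _ ENNReal.ofReal_ne_top,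
          ENNReal.ofReal_add hε.le (by positivity),
          ENNReal.ofReal_mul (p := 2 * ε) (by positivity)]
        simp only [lintegral_const, measure_univ, mul_one]
        exact add_le_add_right (mul_le_mul_right
          (lintegral_sq_sampleMean_le hX hindep (hφs s) (hφb s) hN.ne') _) _
    _ = _ := by simp

/-- A function continuous on a compact interval agrees there with a measurable bounded function. -/
lemma exists_measurable_bounded_eqOn {F : ℝ → ℝ} {a b : ℝ} (hab : a ≤ b)
    (hF : ContinuousOn F (Set.Icc a b)) :
    ∃ G : ℝ → ℝ, Measurable G ∧ Set.EqOn G F (Set.Icc a b) ∧ ∃ M, ∀ x, ‖G x‖ ≤ M := by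
  obtain ⟨M, hM⟩ := isCompact_Icc.exists_bound_of_continuousOn hF
  exact ⟨Set.IccExtend hab ((Set.Icc a b).domRestrict F),
    (hF.domRestrict.Icc_extend' (h := hab)).measurable,
    fun x hx => Set.IccExtend_of_mem hab _ hx, M, fun x => hM _ (Set.projIcc a b hab x).2⟩

/-- Delta method for the integral of a `C¹` function of sample means: a central limit theorem
whose limiting variance is that of the linearization. -/
theorem tendstoInDistribution_integral_sampleMean {E Ω S : Type*} [MeasurableSpace E]
    [MeasurableSpace Ω] [MeasurableSpace S] {σ : Measure S} [IsProbabilityMeasure σ]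
    {μ : Measure E} [IsProbabilityMeasure μ] {P : Measure Ω} [IsProbabilityMeasure P]
    {X : ℕ → Ω → E} (hX : ∀ i, HasLaw (X i) μ P) (hindep : iIndepFun X P)
    {φ : S → E → ℝ} (hφ : Measurable (Function.uncurry φ)) {b : ℝ} (hb : 0 < b)
    (hφb : ∀ s x, φ s x ∈ Set.Icc 0 b) {F : ℝ → ℝ} (hF : ContDiffOn ℝ 1 F (Set.Icc 0 b))
    {G : E → ℝ} (hG : ∀ x, G x =
      ∫ s, derivWithin F (Set.Icc 0 b) (∫ y, φ s y ∂μ) * φ s x ∂σ) :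
    MemLp G 2 μ ∧ TendstoInDistribution (fun (N : ℕ) ω => √(N : ℝ) *
      ((∫ s, F ((N : ℝ)⁻¹ * ∑ i ∈ Finset.range N, φ s (X i ω)) ∂σ) -
        ∫ s, F (∫ x, φ s x ∂μ) ∂σ)) atTop (id : ℝ → ℝ) (fun _ => P)
      (gaussianReal 0 Var[G; μ].toNNReal) := by
  have hφs : ∀ s, Measurable (φ s) := fun s => hφ.of_uncurry_left
  have hφx : ∀ x, Measurable fun s => φ s x := fun x => hφ.of_uncurry_right
  set q : S → ℝ := fun s => ∫ x, φ s x ∂μ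
  set m : ℕ → S → Ω → ℝ := fun N s ω => (N : ℝ)⁻¹ * ∑ i ∈ Finset.range N, φ s (X i ω)
  have hq : Measurable q := (hφ.stronglyMeasurable.integral_prod_right').measurable
  have hφn : ∀ s x, ‖φ s x‖ ≤ b := fun s x => by
    rw [Real.norm_eq_abs, abs_of_nonneg (hφb _ _).1]; exact (hφb _ _).2
  have hmem : ∀ s, q s ∈ Set.Icc 0 b := fun s => by
    have hi : Integrable (φ s) μ := .of_bound (hφs s).aestronglyMeasurable b (ae_of_all _ (hφn s))
    refine ⟨integral_nonneg fun x => (hφb s x).1, ?_⟩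
    simpa using integral_mono hi (integrable_const b) fun x => (hφb s x).2
  have hmemN : ∀ (N : ℕ) s ω, m N s ω ∈ Set.Icc 0 b := by
    intro N s ω
    refine ⟨mul_nonneg (by positivity) (Finset.sum_nonneg fun i _ => (hφb _ _).1), ?_⟩
    rcases Nat.eq_zero_or_pos N with rfl | hN
    · simpa [m] using hb.le
    · rw [inv_mul_le_iff₀ (by positivity)]
      exact (Finset.sum_le_card_nsmul _ _ b fun i _ => (hφb _ _).2).trans (by simp)
  -- `F` and its derivative are arbitrary off `[0, b]`. All arguments lie in that interval, so
  -- bounded measurable extensions may replace them.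
  obtain ⟨F₀, hF₀m, hF₀, M₀, hM₀⟩ := exists_measurable_bounded_eqOn hb.le hF.continuousOn
  obtain ⟨F₁, hF₁m, hF₁, M₁, hM₁⟩ := exists_measurable_bounded_eqOn hb.le
    (hF.continuousOn_derivWithin (uniqueDiffOn_Icc hb) le_rfl)
  have hM₁0 : 0 ≤ M₁ := (norm_nonneg _).trans (hM₁ 0)
  have hG₁ : ∀ x, G x = ∫ s, F₁ (q s) * φ s x ∂σ := fun x => by
    rw [hG x]
    exact integral_congr_ae (ae_of_all _ fun s => by simp only [q, hF₁ (hmem s)])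
  have hbd : ∀ s x, ‖F₁ (q s) * φ s x‖ ≤ M₁ * b := fun s x => by
    rw [norm_mul]
    exact mul_le_mul (hM₁ _) (hφn s x) (norm_nonneg _) hM₁0
  have hGm : Measurable G := by
    rw [funext hG₁]
    have : StronglyMeasurable fun p : E × S => F₁ (q p.2) * φ p.2 p.1 :=
      ((hF₁m.comp (hq.comp measurable_snd)).mul (hφ.comp measurable_swap)).stronglyMeasurable
    exact this.integral_prod_right'.measurable
  have hGb : ∀ x, ‖G x‖ ≤ M₁ * b := fun x => by
    rw [hG₁ x]
    simpa using norm_integral_le_of_norm_le_const (μ := σ) (ae_of_all _ fun s => hbd s x)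
  have hGLp : MemLp G 2 μ := .of_bound hGm.aestronglyMeasurable _ (ae_of_all _ hGb)
  refine ⟨hGLp, ?_⟩
  have hGint : ∫ x, G x ∂μ = ∫ s, F₁ (q s) * q s ∂σ := by
    simp_rw [hG₁]
    rw [integral_integral_swap]
    · simp_rw [integral_const_mul]; rfl
    · exact .of_bound ((hF₁m.comp (hq.comp measurable_snd)).mul
        (hφ.comp measurable_swap)).aestronglyMeasurable (M₁ * b) (ae_of_all _ fun p => hbd _ _)
  have hclt := tendstoInDistribution_inv_sqrt_mul_sum_sub (P := P) (X := fun i => G ∘ X i)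
    (P' := gaussianReal 0 Var[G; μ].toNNReal) (Y := id)
    (by
      rw [show Var[G ∘ X 0; P] = Var[G; μ] by
        rw [← (hX 0).map_eq, variance_map hGm.aemeasurable (hX 0).aemeasurable]]
      exact .id)
    (.of_bound (hGm.comp_aemeasurable (hX 0).aemeasurable).aestronglyMeasurable _
      (ae_of_all _ fun ω => hGb _))
    (hindep.comp _ fun _ => hGm)
    (fun i => IdentDistrib.comp ⟨(hX i).aemeasurable, (hX 0).aemeasurable,
      by rw [(hX i).map_eq, (hX 0).map_eq]⟩ hGm)
  have hE : ∫ ω, (G ∘ X 0) ω ∂P = ∫ x, G x ∂μ := (hX 0).integral_comp hGm.aestronglyMeasurable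
  rw [hE] at hclt
  have hmm : ∀ N, AEMeasurable (fun p : Ω × S => m N p.2 p.1) (P.prod σ) := fun N =>
    .const_mul (Finset.aemeasurable_fun_sum _ fun i _ => hφ.comp_aemeasurable
      (((measurable_snd (α := Ω)).aemeasurable).prodMk
        ((hX i).aemeasurable.comp_quasiMeasurePreserving Measure.quasiMeasurePreserving_fst))) _
  have hms : ∀ N ω, Measurable fun s => m N s ω := fun N ω =>
    (Finset.measurable_fun_sum _ fun i _ => hφx _).const_mul _
  have hFq : ∀ s, F (q s) = F₀ (q s) := fun s => (hF₀ (hmem s)).symm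
  have hFm : ∀ N s ω, F (m N s ω) = F₀ (m N s ω) := fun N s ω => (hF₀ (hmemN N s ω)).symm
  have hmeas : ∀ N : ℕ, AEMeasurable (fun ω => √(N : ℝ) *
      ((∫ s, F (m N s ω) ∂σ) - ∫ s, F (q s) ∂σ)) P := by
    intro N
    simp_rw [hFm]
    exact ((((hF₀m.comp_aemeasurable (hmm N)).aestronglyMeasurable).integral_prod_right'
      ).aemeasurable.sub_const _).const_mul _
  -- Slutsky: the difference from the CLT sequence is exactly the rescaled remainder.
  refine tendstoInDistribution_of_tendstoInMeasure_sub (μ'' := P)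
    (μ' := gaussianReal 0 Var[G; μ].toNNReal) _ _ hclt ?_ hmeas
  refine tendstoInMeasure_of_tendsto_eLpNorm one_ne_zero
    (fun N => ((hmeas N).sub (hclt.forall_aemeasurable N)).aestronglyMeasurable)
    aestronglyMeasurable_zero ?_
  refine (tendsto_lintegral_remainder (σ := σ) hX hindep hφ hb hφb hF).congr fun N => ?_
  rw [sub_zero, eLpNorm_one_eq_lintegral_enorm]
  refine lintegral_congr fun ω => ?_
  congr 1
  simp only [Pi.sub_apply, Function.comp_apply]
  have i1 : Integrable (fun s => F₀ (m N s ω)) σ :=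
    .of_bound (hF₀m.comp (hms N ω)).aestronglyMeasurable M₀ (ae_of_all _ fun s => hM₀ _)
  have i2 : Integrable (fun s => F₀ (q s)) σ :=
    .of_bound (hF₀m.comp hq).aestronglyMeasurable M₀ (ae_of_all _ fun s => hM₀ _)
  have i3 : ∀ x, Integrable (fun s => F₁ (q s) * φ s x) σ := fun x =>
    .of_bound ((hF₁m.comp hq).mul (hφx x)).aestronglyMeasurable (M₁ * b)
      (ae_of_all _ fun s => hbd s x)
  have i4 : Integrable (fun s => F₁ (q s) * q s) σ :=
    .of_bound ((hF₁m.comp hq).mul hq).aestronglyMeasurable (M₁ * b) (ae_of_all _ fun s => by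
      rw [norm_mul]
      refine mul_le_mul (hM₁ _) ?_ (norm_nonneg _) hM₁0
      rw [Real.norm_eq_abs, abs_of_nonneg (hmem s).1]; exact (hmem s).2)
  have i5 : Integrable (fun s => (N : ℝ)⁻¹ * ∑ i ∈ Finset.range N, F₁ (q s) * φ s (X i ω)) σ :=
    (integrable_finsetSum _ fun i _ => i3 (X i ω)).const_mul _
  have hpt : ∀ s, F (m N s ω) - F (q s) - derivWithin F (Set.Icc 0 b) (q s) * (m N s ω - q s) =
      F₀ (m N s ω) - F₀ (q s) - ((N : ℝ)⁻¹ * ∑ i ∈ Finset.range N, F₁ (q s) * φ s (X i ω) -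
        F₁ (q s) * q s) := fun s => by
    rw [hFm, hFq, ← hF₁ (hmem s), ← Finset.mul_sum]
    simp only [m]
    ring
  change √(N : ℝ) * ∫ s, (F (m N s ω) - F (q s) -
    derivWithin F (Set.Icc 0 b) (q s) * (m N s ω - q s)) ∂σ =
    √(N : ℝ) * ((∫ s, F (m N s ω) ∂σ) - ∫ s, F (q s) ∂σ) -
      (√(N : ℝ))⁻¹ * (∑ i ∈ Finset.range N, G (X i ω) - N * ∫ x, G x ∂μ)
  simp_rw [hpt]
  simp_rw [hFm, hFq]
  rw [integral_sub (by exact i1.sub i2) (by exact i5.sub i4), integral_sub i1 i2, integral_sub i5 i4,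
    integral_const_mul, integral_finsetSum _ fun i _ => i3 (X i ω), hGint]
  simp_rw [← hG₁]
  rcases Nat.eq_zero_or_pos N with rfl | hN
  · simp
  · have h0 : √(N : ℝ) ≠ 0 := (Real.sqrt_pos.2 (by positivity)).ne'
    have hsq : (N : ℝ) = √(N : ℝ) * √(N : ℝ) := (Real.mul_self_sqrt (by positivity)).symm
    rw [mul_sub]
    congr 1
    generalize √(N : ℝ) = r at h0 hsq
    rw [hsq]
    field_simp

/-! ### Rank distributions on the line -/

lemma measurable_rank {K : ℕ} : Measurable fun p : ℝ × (Fin K → ℝ) => rank p.1 p.2 := by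
  unfold rank
  simp_rw [Finset.card_filter]
  refine Finset.measurable_fun_sum _ fun j _ => ?_
  exact Measurable.ite (measurableSet_le ((measurable_pi_apply j).comp measurable_snd)
    measurable_fst) measurable_const measurable_const

lemma rank_le {K : ℕ} (x : ℝ) (y : Fin K → ℝ) : rank x y ≤ K :=
  (Finset.card_filter_le _ _).trans (by simp)

lemma measurable_rankProb (K : ℕ) (ν : Measure ℝ) [IsProbabilityMeasure ν] (n : ℕ) :
    Measurable fun x => rankProb K ν x n :=
  (measurable_measure_prodMk_left (ν := Measure.pi fun _ : Fin K => ν)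
    (measurable_rank (measurableSet_singleton n))).ennreal_toReal

lemma rankProb_mem_Icc (K : ℕ) (ν : Measure ℝ) [IsProbabilityMeasure ν] (x : ℝ) (n : ℕ) :
    rankProb K ν x n ∈ Set.Icc 0 1 :=
  ⟨measureReal_nonneg, measureReal_le_one⟩

lemma rankPMF_mem_Icc (K : ℕ) (μ ν : Measure ℝ) [IsProbabilityMeasure μ] [IsProbabilityMeasure ν]
    (n : ℕ) : rankPMF K μ ν n ∈ Set.Icc 0 1 :=
  ⟨measureReal_nonneg, measureReal_le_one⟩

lemma sum_rankPMF (K : ℕ) (μ ν : Measure ℝ) [IsProbabilityMeasure μ] [IsProbabilityMeasure ν] :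
    ∑ n ∈ Finset.range (K + 1), rankPMF K μ ν n = 1 := by
  have h := sum_measureReal_preimage_singleton (μ := μ.prod (Measure.pi fun _ : Fin K => ν))
    (Finset.range (K + 1)) (f := fun p => rank p.1 p.2)
    fun n _ => measurable_rank (measurableSet_singleton n)
  refine h.trans ?_
  rw [Set.eq_univ_of_forall (s := _ ⁻¹' _) fun p => ?_, probReal_univ]
  simpa using Nat.lt_succ_of_le (rank_le p.1 p.2)

/-- The rank distribution of `Y ∼ μ` is the mixture over `μ` of those of fixed points. -/
lemma rankPMF_eq_integral (K : ℕ) (μ ν : Measure ℝ) [IsProbabilityMeasure μ]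
    [IsProbabilityMeasure ν] (n : ℕ) : rankPMF K μ ν n = ∫ x, rankProb K ν x n ∂μ := by
  have hm := measurable_rank (K := K) (measurableSet_singleton n)
  unfold rankPMF rankProb
  simp only [measureReal_def]
  refine Eq.trans ?_ (integral_toReal (measurable_measure_prodMk_left hm).aemeasurable
    (ae_of_all _ fun x => measure_lt_top _ _)).symm
  exact congrArg ENNReal.toReal (Measure.prod_apply hm)

lemma measurable_comp_of_continuousOn_Icc {α : Type*} [MeasurableSpace α] {F : ℝ → ℝ}
    {a b : ℝ} (hF : ContinuousOn F (Set.Icc a b)) {q : α → ℝ} (hq : Measurable q)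
    (hqb : ∀ s, q s ∈ Set.Icc a b) : Measurable fun s => F (q s) :=
  hF.domRestrict.measurable.comp (hq.subtype_mk (h := hqb))

/-! ### Joint measurability along slices -/

section Slice

variable {d : ℕ} (K : ℕ) (μ ν : Measure (EuclideanSpace ℝ (Fin d)))

lemma measurable_inner_left (s : USphere d) :
    Measurable fun x => inner ℝ (s : EuclideanSpace ℝ (Fin d)) x := by fun_prop

instance [IsProbabilityMeasure μ] (s : USphere d) : IsProbabilityMeasure (slice μ s) :=
  Measure.isProbabilityMeasure_map (measurable_inner_left s).aemeasurable

/-- Draws from `slice ν s` are projections of draws from `ν`. Pulling back to `ν` moves the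
dependence on `s` from the measure into the event, so measurability of section measures applies. -/
lemma measurable_rankProb_slice [IsProbabilityMeasure ν] (n : ℕ) :
    Measurable fun p : USphere d × EuclideanSpace ℝ (Fin d) =>
      rankProb K (slice ν p.1) (inner ℝ (p.1 : EuclideanSpace ℝ (Fin d)) p.2) n := by
  have hr : Measurable fun r : (USphere d × EuclideanSpace ℝ (Fin d)) ×
      (Fin K → EuclideanSpace ℝ (Fin d)) =>
      rank (inner ℝ (r.1.1 : EuclideanSpace ℝ (Fin d)) r.1.2)
        fun j => inner ℝ (r.1.1 : EuclideanSpace ℝ (Fin d)) (r.2 j) := by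
    refine measurable_rank.comp (Measurable.prodMk (by fun_prop) ?_)
    exact measurable_pi_lambda _ fun j => by fun_prop
  convert! (measurable_measure_prodMk_left (ν := Measure.pi fun _ : Fin K => ν)
    (hr (measurableSet_singleton n))).ennreal_toReal using 2 with p
  unfold rankProb slice
  have : ∀ _ : Fin K, SigmaFinite
      (ν.map fun x => inner ℝ (p.1 : EuclideanSpace ℝ (Fin d)) x) := fun _ => by
    have : IsProbabilityMeasure (slice ν p.1) := inferInstance
    exact inferInstanceAs (SigmaFinite (slice ν p.1))
  rw [← Measure.pi_map_pi fun _ => (measurable_inner_left p.1).aemeasurable,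
    map_measureReal_apply]
  · rfl
  · exact measurable_pi_lambda _ fun j => (measurable_inner_left p.1).comp (measurable_pi_apply j)
  · exact (measurable_rank.comp measurable_prodMk_left) (measurableSet_singleton n)

lemma rankPMF_slice [IsProbabilityMeasure μ] [IsProbabilityMeasure ν] (s : USphere d) (n : ℕ) :
    rankPMF K (slice μ s) (slice ν s) n =
      ∫ x, rankProb K (slice ν s) (inner ℝ (s : EuclideanSpace ℝ (Fin d)) x) n ∂μ := by
  rw [rankPMF_eq_integral, slice, integral_map (measurable_inner_left s).aemeasurable
    (measurable_rankProb K _ n).aestronglyMeasurable]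

lemma measurable_rankPMF_slice [IsProbabilityMeasure μ] [IsProbabilityMeasure ν] (n : ℕ) :
    Measurable fun s : USphere d => rankPMF K (slice μ s) (slice ν s) n := by
  simp_rw [rankPMF_slice]
  exact (measurable_rankProb_slice K ν n).stronglyMeasurable.integral_prod_right'.measurable

end Slice

/-! ### Empirical measures and real-valued divergences -/

lemma isProbabilityMeasure_empiricalMeasure {E : Type*} [MeasurableSpace E] (x : ℕ → E) {N : ℕ}
    (hN : N ≠ 0) : IsProbabilityMeasure (empiricalMeasure x N) := by
  refine ⟨?_⟩
  simp [empiricalMeasure, ENNReal.inv_mul_cancel, hN]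

lemma integral_empiricalMeasure {E : Type*} [MeasurableSpace E] (x : ℕ → E) (N : ℕ)
    {g : E → ℝ} (hg : Measurable g) :
    ∫ y, g y ∂(empiricalMeasure x N) = (N : ℝ)⁻¹ * ∑ i ∈ Finset.range N, g (x i) := by
  rw [empiricalMeasure, integral_smul_measure, integral_finsetSum_measure fun i _ =>
    ⟨hg.aestronglyMeasurable, ?_⟩]
  · simp [integral_dirac' _ _ hg.stronglyMeasurable]
  · rw [HasFiniteIntegral, lintegral_dirac' _ hg.enorm]
    exact enorm_lt_top

/-- The rank divergence is real and nonnegative. -/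
lemma rankDivergence_eq_coe {f : ℝ → EReal} (hf : IsEntropyFunction f) {K : ℕ} (hf1 : IsC1 f K)
    (μ ν : Measure ℝ) [IsProbabilityMeasure μ] [IsProbabilityMeasure ν] :
    rankDivergence f K μ ν = (((K + 1 : ℝ)⁻¹ *
        ∑ n ∈ Finset.range (K + 1), (f ((K + 1) * rankPMF K μ ν n)).toReal : ℝ) : EReal) ∧
      0 ≤ (K + 1 : ℝ)⁻¹ *
        ∑ n ∈ Finset.range (K + 1), (f ((K + 1) * rankPMF K μ ν n)).toReal := by
  have hK : (0 : ℝ) < K + 1 := by positivity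
  have hmem : ∀ n, (K + 1 : ℝ) * rankPMF K μ ν n ∈ Set.Icc (0 : ℝ) (K + 1) := fun n => by
    have := rankPMF_mem_Icc K μ ν n
    exact ⟨mul_nonneg hK.le this.1, mul_le_of_le_one_right hK.le this.2⟩
  have hcoe : ∀ t ∈ Set.Icc (0 : ℝ) (K + 1), (((f t).toReal : ℝ) : EReal) = f t := fun t ht =>
    EReal.coe_toReal (hf1.1 t ht) (hf.ne_bot t ht.1)
  constructor
  · rw [rankDivergence, EReal.coe_mul]
    congr 1
    rw [show ((∑ n ∈ Finset.range (K + 1), (f ((K + 1) * rankPMF K μ ν n)).toReal : ℝ) : EReal) =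
      ∑ n ∈ Finset.range (K + 1), (((f ((K + 1) * rankPMF K μ ν n)).toReal : ℝ) : EReal) from
        map_sum (⟨⟨Real.toEReal, rfl⟩, EReal.coe_add⟩ : ℝ →+ EReal) _ _]
    exact Finset.sum_congr rfl fun n _ => (hcoe _ (hmem n)).symm
  · have hconv : ConvexOn ℝ (Set.Icc (0 : ℝ) (K + 1)) fun t => (f t).toReal := by
      refine ⟨convex_Icc _ _, fun x hx y hy a b ha hb hab => ?_⟩
      have h := hf.convex x y a b hx.1 hy.1 ha hb hab
      have hm : a * x + b * y ∈ Set.Icc (0 : ℝ) (K + 1) := convex_Icc _ _ hx hy ha hb hab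
      rw [← hcoe _ hx, ← hcoe _ hy, ← hcoe _ hm] at h
      exact_mod_cast h
    -- Jensen with uniform weights: the points `(K + 1) * Q(n)` have barycentre `1`, where `f`
    -- vanishes.
    have h := hconv.map_sum_le (t := Finset.range (K + 1)) (w := fun _ => (K + 1 : ℝ)⁻¹)
      (p := fun n => (K + 1 : ℝ) * rankPMF K μ ν n) (fun _ _ => by positivity)
      (by simp [hK.ne']) fun n _ => hmem n
    simp only [smul_eq_mul] at h
    rw [← Finset.mul_sum, ← Finset.mul_sum, ← Finset.mul_sum, sum_rankPMF, mul_one,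
      inv_mul_cancel₀ hK.ne', hf.one] at h
    simpa using h

lemma toReal_slicedRankDivergence {d : ℕ} {f : ℝ → EReal} (hf : IsEntropyFunction f) {K : ℕ}
    (hf1 : IsC1 f K) (μ ν : Measure (EuclideanSpace ℝ (Fin d))) [IsProbabilityMeasure μ]
    [IsProbabilityMeasure ν] :
    (slicedRankDivergence f K μ ν).toReal = ∫ s, (K + 1 : ℝ)⁻¹ * ∑ n ∈ Finset.range (K + 1),
      (f ((K + 1) * rankPMF K (slice μ s) (slice ν s) n)).toReal ∂(uniformSphere d) := by
  have hK : (0 : ℝ) < K + 1 := by positivity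
  rw [integral_eq_lintegral_of_nonneg_ae
    (ae_of_all _ fun s => (rankDivergence_eq_coe hf hf1 (slice μ s) (slice ν s)).2)]
  · simp_rw [slicedRankDivergence, (rankDivergence_eq_coe hf hf1 (slice μ _) (slice ν _)).1,
      EReal.real_coe_toENNReal]
  · refine ((Finset.measurable_fun_sum _ fun n _ => ?_).const_mul _).aestronglyMeasurable
    refine measurable_comp_of_continuousOn_Icc hf1.2.continuousOn
      ((measurable_rankPMF_slice K μ ν n).const_mul _) fun s => ?_
    have := rankPMF_mem_Icc K (slice μ s) (slice ν s) n
    exact ⟨mul_nonneg hK.le this.1, mul_le_of_le_one_right hK.le this.2⟩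

lemma isProbabilityMeasure_uniformSphere {d : ℕ} (hd : d ≠ 0) :
    IsProbabilityMeasure (uniformSphere d) := by
  have : NeZero d := ⟨hd⟩
  have : Nontrivial (EuclideanSpace ℝ (Fin d)) := inferInstance
  have : NeZero (volume : Measure (EuclideanSpace ℝ (Fin d))).toSphere :=
    ⟨Measure.toSphere_ne_zero _⟩
  unfold uniformSphere
  infer_instance

/-! ### Direction and rank as a single parameter -/

/-- The uniform probability measure on `{0, …, K}`. -/
def uniformFin (K : ℕ) : Measure (Fin (K + 1)) :=
  (Measure.count (Set.univ : Set (Fin (K + 1))))⁻¹ • Measure.count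

instance (K : ℕ) : IsProbabilityMeasure (uniformFin K) := by
  unfold uniformFin
  infer_instance

lemma measurable_uncurry_prod_fin {S E : Type*} [MeasurableSpace S] [MeasurableSpace E] {k : ℕ}
    {h : S → E → ℕ → ℝ} (hm : ∀ n, Measurable fun p : S × E => h p.1 p.2 n) :
    Measurable (Function.uncurry fun (p : S × Fin k) x => h p.1 x p.2) := by
  have h₁ : Measurable fun r : (S × E) × Fin k => h r.1.1 r.1.2 r.2 :=
    measurable_from_prod_countable_left fun n => hm n
  have h₂ : Measurable fun r : (S × Fin k) × E => ((r.1.1, r.2), r.1.2) := by fun_prop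
  exact h₁.comp h₂

lemma integral_prod_uniformFin {S : Type*} [MeasurableSpace S] (σ : Measure S)
    [IsProbabilityMeasure σ] (K : ℕ) {h : S → ℕ → ℝ} (hm : ∀ n, Measurable fun s => h s n) {M : ℝ}
    (hM : ∀ s n, ‖h s n‖ ≤ M) :
    ∫ p, h p.1 (p.2 : Fin (K + 1)) ∂(σ.prod (uniformFin K)) =
      ∫ s, (K + 1 : ℝ)⁻¹ * ∑ n ∈ Finset.range (K + 1), h s n ∂σ := by
  have hmeas : Measurable fun p : S × Fin (K + 1) => h p.1 p.2 :=
    measurable_from_prod_countable_left fun n => hm n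
  rw [integral_prod _ (.of_bound hmeas.aestronglyMeasurable M (ae_of_all _ fun p => hM _ _))]
  refine integral_congr_ae (ae_of_all _ fun s => ?_)
  simp only [uniformFin, integral_smul_measure, integral_count, Finset.sum_range, smul_eq_mul]
  congr 1
  simp only [Measure.count_univ, ENat.card_eq_coe_fintype_card, Fintype.card_fin,
    ENNReal.toReal_inv]
  norm_cast

/-- The rank distribution of the projection of a point, rescaled by `K + 1`, as a function of the
direction, the rank and the point. -/
def scaledRankProb {d : ℕ} (K : ℕ) (ν : Measure (EuclideanSpace ℝ (Fin d)))
    (p : USphere d × Fin (K + 1)) (x : EuclideanSpace ℝ (Fin d)) : ℝ :=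
  (K + 1) * rankProb K (slice ν p.1) (inner ℝ (p.1 : EuclideanSpace ℝ (Fin d)) x) p.2

section ScaledRankProb

variable {d : ℕ} {f : ℝ → EReal} {K : ℕ}
  (μ ν : Measure (EuclideanSpace ℝ (Fin d))) [IsProbabilityMeasure μ] [IsProbabilityMeasure ν]

lemma measurable_scaledRankProb : Measurable (Function.uncurry (scaledRankProb K ν)) :=
  measurable_uncurry_prod_fin (h := fun s x n => (K + 1) *
    rankProb K (slice ν s) (inner ℝ (s : EuclideanSpace ℝ (Fin d)) x) n)
    fun n => (measurable_rankProb_slice K ν n).const_mul _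

lemma mul_mem_Icc {c t : ℝ} (hc : 0 ≤ c) (ht : t ∈ Set.Icc (0 : ℝ) 1) : c * t ∈ Set.Icc 0 c :=
  ⟨mul_nonneg hc ht.1, mul_le_of_le_one_right hc ht.2⟩

lemma scaledRankProb_mem_Icc (p : USphere d × Fin (K + 1)) (x : EuclideanSpace ℝ (Fin d)) :
    scaledRankProb K ν p x ∈ Set.Icc (0 : ℝ) (K + 1) :=
  mul_mem_Icc (by positivity) (rankProb_mem_Icc K _ _ _)

lemma integral_scaledRankProb (p : USphere d × Fin (K + 1)) :
    ∫ x, scaledRankProb K ν p x ∂μ = (K + 1) * rankPMF K (slice μ p.1) (slice ν p.1) p.2 := by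
  rw [rankPMF_slice, ← integral_const_mul]
  rfl

lemma toReal_slicedRankDivergence_eq_integral_prod (hf : IsEntropyFunction f) (hf1 : IsC1 f K)
    [IsProbabilityMeasure (uniformSphere d)] :
    (slicedRankDivergence f K μ ν).toReal =
      ∫ p, (f (∫ x, scaledRankProb K ν p x ∂μ)).toReal
        ∂((uniformSphere d).prod (uniformFin K)) := by
  have hmem : ∀ (s : USphere d) n, (K + 1) * rankPMF K (slice μ s) (slice ν s) n ∈
      Set.Icc (0 : ℝ) (K + 1) := fun s n => mul_mem_Icc (by positivity) (rankPMF_mem_Icc K _ _ n)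
  obtain ⟨M, hM⟩ := isCompact_Icc.exists_bound_of_continuousOn hf1.2.continuousOn
  rw [toReal_slicedRankDivergence hf hf1]
  simp_rw [integral_scaledRankProb]
  exact (integral_prod_uniformFin (uniformSphere d) K
    (h := fun s n => (f ((K + 1) * rankPMF K (slice μ s) (slice ν s) n)).toReal)
    (fun n => measurable_comp_of_continuousOn_Icc hf1.2.continuousOn
      ((measurable_rankPMF_slice K μ ν n).const_mul _) fun s => hmem s n)
    fun s n => hM _ (hmem s n)).symm

lemma linearization_eq_integral_prod (hf1 : IsC1 f K) [IsProbabilityMeasure (uniformSphere d)]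
    (x : EuclideanSpace ℝ (Fin d)) :
    linearization f K μ ν x =
      ∫ p, derivWithin (fun t => (f t).toReal) (Set.Icc 0 (K + 1))
        (∫ y, scaledRankProb K ν p y ∂μ) * scaledRankProb K ν p x
        ∂((uniformSphere d).prod (uniformFin K)) := by
  have hK : (0 : ℝ) < K + 1 := by positivity
  have hmem : ∀ (s : USphere d) n, (K + 1) * rankPMF K (slice μ s) (slice ν s) n ∈
      Set.Icc (0 : ℝ) (K + 1) := fun s n => mul_mem_Icc hK.le (rankPMF_mem_Icc K _ _ n)
  have hc := hf1.2.continuousOn_derivWithin (uniqueDiffOn_Icc hK) le_rfl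
  obtain ⟨M, hM⟩ := isCompact_Icc.exists_bound_of_continuousOn hc
  have hrp : ∀ n : ℕ, Measurable fun s : USphere d => rankProb K (slice ν s)
      (inner ℝ (s : EuclideanSpace ℝ (Fin d)) x) n := fun n =>
    Measurable.of_uncurry_right (f := fun (s : USphere d) y =>
      rankProb K (slice ν s) (inner ℝ (s : EuclideanSpace ℝ (Fin d)) y) n)
      (measurable_rankProb_slice K ν n)
  simp_rw [integral_scaledRankProb, scaledRankProb]
  refine Eq.trans ?_ (integral_prod_uniformFin (uniformSphere d) K
    (h := fun s n => derivWithin (fun t => (f t).toReal) (Set.Icc 0 (K + 1))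
      ((K + 1) * rankPMF K (slice μ s) (slice ν s) n) *
      ((K + 1) * rankProb K (slice ν s) (inner ℝ (s : EuclideanSpace ℝ (Fin d)) x) n))
    (M := M * (K + 1)) (fun n => ?_) fun s n => ?_).symm
  · refine integral_congr_ae (ae_of_all _ fun s => ?_)
    simp only [Finset.mul_sum]
    refine Finset.sum_congr rfl fun n _ => ?_
    -- The weight `(K + 1)⁻¹` of the uniform law cancels the scaling of the rank probabilities,
    -- hence no prefactor in `g`.
    rw [mul_left_comm _ (K + 1 : ℝ), mul_left_comm, mul_inv_cancel_left₀ hK.ne']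
  · exact (measurable_comp_of_continuousOn_Icc hc
      ((measurable_rankPMF_slice K μ ν n).const_mul _) fun s => hmem s n).mul
      ((hrp n).const_mul _)
  · have h := mul_mem_Icc hK.le (rankProb_mem_Icc K (slice ν s)
      (inner ℝ (s : EuclideanSpace ℝ (Fin d)) x) n)
    rw [norm_mul]
    refine mul_le_mul (hM _ (hmem s n)) ?_ (norm_nonneg _) ((norm_nonneg _).trans (hM _ (hmem s n)))
    rw [Real.norm_eq_abs, abs_of_nonneg h.1]
    exact h.2

end ScaledRankProb

end RankDiv

end

/-! ### The central limit theorem -/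

theorem theorem3p3 {d : ℕ} (K : ℕ)
    (μ ν : Measure (EuclideanSpace ℝ (Fin d))) [IsProbabilityMeasure μ] [IsProbabilityMeasure ν]
    (hμν : μ ≠ ν)
    (f : ℝ → EReal) (hf : RankDiv.IsEntropyFunction f) (hf1 : RankDiv.IsC1 f K)
    (hD : 0 < RankDiv.slicedRankDivergence f K μ ν)
    {Ω : Type*} [MeasurableSpace Ω] (P : Measure Ω) [IsProbabilityMeasure P]
    (X : ℕ → Ω → EuclideanSpace ℝ (Fin d))
    (hX : ∀ i, HasLaw (X i) μ P) (hindep : iIndepFun X P) :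
    ∃ τ2 : NNReal,
      (τ2 : ℝ) = variance (RankDiv.linearization f K μ ν) μ ∧
      (0 < τ2 ↔ ¬ ∃ c : ℝ, ∀ᵐ x ∂μ, RankDiv.linearization f K μ ν x = c) ∧
      TendstoInDistribution
        (fun (N : ℕ) (ω : Ω) => √(N : ℝ) *
          ((RankDiv.slicedRankDivergence f K
              (RankDiv.empiricalMeasure (fun i => X i ω) N) ν).toReal -
            (RankDiv.slicedRankDivergence f K μ ν).toReal))
        atTop (id : ℝ → ℝ) (fun _ => P) (gaussianReal 0 τ2) := by
  -- `ℝ^0` is a point and carries only one probability measure.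
  have hd : d ≠ 0 := by
    rintro rfl
    refine hμν (Measure.ext fun s _ => ?_)
    rcases s.eq_empty_or_nonempty with rfl | hs
    · simp
    · rw [Subsingleton.eq_univ_of_nonempty hs, measure_univ, measure_univ]
  have := RankDiv.isProbabilityMeasure_uniformSphere hd
  obtain ⟨hLp, hlim⟩ := RankDiv.tendstoInDistribution_integral_sampleMean hX hindep
    (RankDiv.measurable_scaledRankProb ν) (by positivity) (RankDiv.scaledRankProb_mem_Icc ν) hf1.2
    (RankDiv.linearization_eq_integral_prod μ ν hf1)
  refine ⟨Var[RankDiv.linearization f K μ ν; μ].toNNReal,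
    Real.coe_toNNReal _ (variance_nonneg _ _), ?_, ?_⟩
  · rw [Real.toNNReal_pos, (variance_nonneg _ _).lt_iff_ne', Ne, not_iff_not]
    refine ⟨fun h => ⟨_, ae_eq_integral_of_variance_eq_zero hLp h⟩, fun ⟨c, hc⟩ => ?_⟩
    rw [variance_congr (Y := fun _ => c) hc, variance_eq_integral aemeasurable_const]
    simp
  · refine hlim.congr (fun N => ae_of_all _ fun ω => ?_) (ae_eq_refl _)
    -- For `N = 0` the empirical measure is not a probability, but the factor `√0` kills both sides.
    rcases eq_or_ne N 0 with rfl | hN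
    · simp
    have := RankDiv.isProbabilityMeasure_empiricalMeasure (fun i => X i ω) hN
    simp only [RankDiv.toReal_slicedRankDivergence_eq_integral_prod _ ν hf hf1,
      RankDiv.integral_empiricalMeasure _ _
        ((RankDiv.measurable_scaledRankProb ν).of_uncurry_left)]
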